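/- Consider a microgrid with $N$ inverter-based resources (IBRs). For $n=1,\dots,N$ the small-signal dynamics of IBR $n$ in its own d-q frame is the linear system $$\Delta\dot{\mathbf x}_n=A_n\Delta\mathbf x_n+B_n\Delta\mathbf i_{\mathrm{odq}n},\qquad \Delta\mathbf v_{\mathrm{odq}n}=C_n\Delta\mathbf x_n,\qquad \Delta\mathbf i_{\mathrm{odq}n},\Delta\mathbf v_{\mathrm{odq}n}\in\mathbb R^2,$$ with real matrices $A_n,B_n,C_n$ such that $(A_n,B_n)$ is stabilizable and $(A_n,C_n)$ is detectable (no uncontrollable or unobservable mode of $A_n$ has nonnegative real part; this holds in particular if every $A_n$ is Hurwitz). With a constant angle $\delta_n$ and the rotation $T_n=\begin{bmatrix}\cos\delta_n&-\sin\delta_n\\ \sin\delta_n&\cos\delta_n\end{bmatrix}$, its variables in the common D-Q frame are given by $\Delta\mathbf v_{\mathrm{oDQ}n}=T_n\Delta\mathbf v_{\mathrm{odq}n}$ and $\Delta\mathbf i_{\mathrm{odq}n}=T_n^{-1}\Delta\mathbf i_{\mathrm{oDQ}n}$. The network has the nodes $0,1,\dots,N$, where $0$ is the neutral point and IBR $n$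 is connected between $0$ and $n$, and $M'$ further branches. Branch $m$ joins two nodes $i<j$, is directed from $i$ to $j$, and is an RL circuit with resistance $r_m>0$ and inductance $L_m>0$. Let $C_0\in\mathbb R^{N\times M'}$ be the reduced incidence matrix of these branches: the entry $(n,m)$ is $1$ if branch $m$ leaves node $n$, $-1$ if it enters node $n$, and $0$ otherwise. With a constant nominal frequency $\omega_0\in\mathbb R$ the branch currents satisfy, for $m=1,\dots,M'$, $$L_m\Delta\dot i_{\mathrm{bD}m}=-r_m\Delta i_{\mathrm{bD}m}+\omega_0L_m\Delta i_{\mathrm{bQ}m}+\Delta v_{\mathrm{bD}m},\qquad L_m\Delta\dot i_{\mathrm{bQ}m}=-r_m\Delta i_{\mathrm{bQ}m}-\omega_0L_m\Delta i_{\mathrm{bD}m}+\Delta v_{\mathrm{bQ}m},$$ where $\Delta\mathbf v_{\mathrm{bD}}=C_0^\top\Delta\mathbf v_{\mathrm{oD}}$ and $\Delta\mathbf v_{\mathrm{bQ}}=C_0^\top\Delta\mathbf v_{\mathrm{oQ}}$. The currents entering the network at the nodes are $\Delta\mathbf i_{\mathrm{sD}}=C_0\Delta\mathbf i_{\mathrm{bD}}$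 and $\Delta\mathbf i_{\mathrm{sQ}}=C_0\Delta\mathbf i_{\mathrm{bQ}}$. The loop is closed by $\Delta\mathbf i_{\mathrm{oDQ}}=-\Delta\mathbf i_{\mathrm{sDQ}}$, and the closed-loop state collects all $\Delta\mathbf x_n$ and all $\Delta i_{\mathrm{bD}m},\Delta i_{\mathrm{bQ}m}$. A system with input $\mathbf u$ and output $\mathbf y$ is called output feedback passive (OFP) if there is $\sigma>0$ such that, with zero initial condition, $$\int_0^t\mathbf u(\tau)^\top\mathbf y(\tau)\,d\tau-\sigma\int_0^t\mathbf y(\tau)^\top\mathbf y(\tau)\,d\tau\ge0\qquad\text{for all square integrable }\mathbf u\text{ on }[0,\infty)\text{ and all }t\ge0.$$ Theorem. If for every $n=1,\dots,N$ the dynamics of IBR $n$ with input $\Delta\mathbf i_{\mathrm{odq}n}$ and output $\Delta\mathbf v_{\mathrm{odq}n}$ is OFP (Protocol 1), then the origin is an asymptotically stable equilibrium point of the closed-loop system $\dot{\mathbf x}=\mathbf f(\mathbf x)$: for every $\epsilon>0$ there is $\rho>0$ such that $\|\mathbf x(0)\|<\rho$ implies $\|\mathbf x(t)\|<\epsilon$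 for all $t\ge0$, and for some $\rho>0$, $\|\mathbf x(0)\|<\rho$ implies $\lim_{t\to\infty}\mathbf x(t)=\mathbf o$. -/

import Mathlib

open scoped Matrix

noncomputable section

/-! ### Input-output passivity and asymptotic stability -/

/-- Square integrability of a vector signal on the half-line `[0, ∞)`. -/
def IsSquareIntegrable {d : ℕ} (u : ℝ → Fin d → ℝ) : Prop :=
  MeasureTheory.MemLp u 2 (MeasureTheory.volume.restrict (Set.Ici (0 : ℝ)))

/-- Output feedback passivity with index `σ` of an input-output system. The system is given by the
relation `H u y`: "`y` is the output produced by the input `u` from the zero initial condition". -/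
def IsOFPWith {d : ℕ} (H : (ℝ → Fin d → ℝ) → (ℝ → Fin d → ℝ) → Prop) (σ : ℝ) : Prop :=
  ∀ u y : ℝ → Fin d → ℝ, IsSquareIntegrable u → H u y → ∀ t : ℝ, 0 ≤ t →
    0 ≤ (∫ τ in (0 : ℝ)..t, u τ ⬝ᵥ y τ) - σ * ∫ τ in (0 : ℝ)..t, y τ ⬝ᵥ y τ

/-- Output feedback passivity (OFP): there is a positive passivity index. -/
def IsOFP {d : ℕ} (H : (ℝ → Fin d → ℝ) → (ℝ → Fin d → ℝ) → Prop) : Prop :=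
  ∃ σ : ℝ, 0 < σ ∧ IsOFPWith H σ

/-- `x` solves the autonomous differential equation `ẋ = f x` on `[0, ∞)`. -/
def IsSolution {E : Type*} [NormedAddCommGroup E] [NormedSpace ℝ E] (f : E → E) (x : ℝ → E) :
    Prop :=
  ∀ t : ℝ, 0 ≤ t → HasDerivWithinAt x (f (x t)) (Set.Ici 0) t

/-- The origin is an asymptotically stable equilibrium point of `ẋ = f x`. -/
def IsAsymptoticallyStableOrigin {E : Type*} [NormedAddCommGroup E] [NormedSpace ℝ E]
    (f : E → E) : Prop :=
  f 0 = 0 ∧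
  (∀ ε : ℝ, 0 < ε → ∃ ρ : ℝ, 0 < ρ ∧ ∀ x : ℝ → E, IsSolution f x →
    ‖x 0‖ < ρ → ∀ t : ℝ, 0 ≤ t → ‖x t‖ < ε) ∧
  (∃ ρ : ℝ, 0 < ρ ∧ ∀ x : ℝ → E, IsSolution f x →
    ‖x 0‖ < ρ → Filter.Tendsto x Filter.atTop (nhds 0))

/-! ### Inverter-based resources -/

/-- The small-signal model of an inverter-based resource in its own d-q frame,
`Δẋ = A Δx + B Δi_odq`, `Δv_odq = C Δx`, together with the constant angle `δ` between
its d-q frame and the common D-Q frame. -/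
structure IBR where
  /-- number of internal states -/
  dim : ℕ
  A : Matrix (Fin dim) (Fin dim) ℝ
  B : Matrix (Fin dim) (Fin 2) ℝ
  C : Matrix (Fin 2) (Fin dim) ℝ
  δ : ℝ

namespace IBR

/-- The rotation from the d-q frame of the IBR to the common D-Q frame. -/
def T (g : IBR) : Matrix (Fin 2) (Fin 2) ℝ :=
  !![Real.cos g.δ, -Real.sin g.δ; Real.sin g.δ, Real.cos g.δ]

/-- `x` is the state trajectory from `x 0 = 0` under the d-q current `i`. As `i` need only be
locally integrable, the state equation is understood in integrated (Carathéodory) form. -/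
def IsZeroStateTrajectory (g : IBR) (i : ℝ → Fin 2 → ℝ) (x : ℝ → Fin g.dim → ℝ) : Prop :=
  ContinuousOn x (Set.Ici 0) ∧
  ∀ t : ℝ, 0 ≤ t → x t = ∫ τ in (0 : ℝ)..t, (g.A *ᵥ x τ + g.B *ᵥ i τ)

/-- The input-output relation from `Δi_odq` to `Δv_odq` with zero initial condition. -/
def inputOutput (g : IBR) (i v : ℝ → Fin 2 → ℝ) : Prop :=
  ∃ x : ℝ → Fin g.dim → ℝ, g.IsZeroStateTrajectory i x ∧ ∀ t : ℝ, 0 ≤ t → v t = g.C *ᵥ x t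

/-- Stabilizability of `(A, B)` (Hautus form): no mode with nonnegative real part is
uncontrollable. -/
def IsStabilizable (g : IBR) : Prop :=
  ∀ z : ℂ, 0 ≤ z.re → ∀ w : Fin g.dim → ℂ,
    w ᵥ* g.A.map Complex.ofReal = z • w → w ᵥ* g.B.map Complex.ofReal = 0 → w = 0

/-- Detectability of `(A, C)` (Hautus form): no mode with nonnegative real part is
unobservable. -/
def IsDetectable (g : IBR) : Prop :=
  ∀ z : ℂ, 0 ≤ z.re → ∀ w : Fin g.dim → ℂ,
    g.A.map Complex.ofReal *ᵥ w = z • w → g.C.map Complex.ofReal *ᵥ w = 0 → w = 0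

end IBR

/-! ### The RL network -/

/-- A Kron-reduced RL network with nodes `0, 1, …, N` (`0` is the neutral point, IBR number `n` is
connected between `0` and node `n.succ`) and `M` RL branches that contain no IBR.
Branch `m` joins the nodes `src m < tgt m` and is directed from `src m` to `tgt m`. -/
structure RLNetwork (N M : ℕ) where
  src : Fin M → Fin (N + 1)
  tgt : Fin M → Fin (N + 1)
  src_lt_tgt : ∀ m, src m < tgt m
  /-- branch resistances -/
  r : Fin M → ℝ
  /-- branch inductances -/
  L : Fin M → ℝ
  r_pos : ∀ m, 0 < r m
  L_pos : ∀ m, 0 < L m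
  /-- nominal angular frequency of the rotating D-Q frame -/
  ω₀ : ℝ

namespace RLNetwork

variable {N M : ℕ}

/-- The reduced incidence matrix of the RL branches (the row of the neutral node is dropped):
`1` if the branch leaves the node, `-1` if it enters the node, `0` otherwise. -/
def C₀ (net : RLNetwork N M) : Matrix (Fin N) (Fin M) ℝ :=
  Matrix.of fun n m =>
    if net.src m = n.succ then 1 else if net.tgt m = n.succ then -1 else 0

/-- Currents injected into the network at the nodes, `i_sD = C₀ i_bD` and `i_sQ = C₀ i_bQ`.
The last index of a D-Q quantity is `0` for the D axis and `1` for the Q axis. -/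
def nodalCurrent (net : RLNetwork N M) (i : Fin M → Fin 2 → ℝ) : Fin N → Fin 2 → ℝ :=
  fun n a => (net.C₀ *ᵥ fun m => i m a) n

/-- Voltages across the branches, `v_bD = C₀ᵀ v_oD` and `v_bQ = C₀ᵀ v_oQ`. -/
def branchVoltage (net : RLNetwork N M) (v : Fin N → Fin 2 → ℝ) : Fin M → Fin 2 → ℝ :=
  fun m a => (net.C₀ᵀ *ᵥ fun n => v n a) m

/-- Time derivative of the branch currents in the D-Q frame:
`L i̇_D = -r i_D + ω₀ L i_Q + v_bD`, `L i̇_Q = -r i_Q - ω₀ L i_D + v_bQ`. -/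
def branchDynamics (net : RLNetwork N M) (i : Fin M → Fin 2 → ℝ) (v : Fin N → Fin 2 → ℝ) :
    Fin M → Fin 2 → ℝ :=
  fun m =>
    ![(-net.r m * i m 0 + net.ω₀ * net.L m * i m 1 + net.branchVoltage v m 0) / net.L m,
      (-net.r m * i m 1 - net.ω₀ * net.L m * i m 0 + net.branchVoltage v m 1) / net.L m]

end RLNetwork

/-! ### The feedback interconnection -/

/-- States of the microgrid: the internal states of all IBRs and the D-Q currents of the RL
branches. -/
abbrev MicrogridState {N : ℕ} (M : ℕ) (g : Fin N → IBR) : Type :=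
  ((n : Fin N) → Fin (g n).dim → ℝ) × (Fin M → Fin 2 → ℝ)

/-- Terminal voltages of the IBRs in the common frame, `v_oDQ = T v_odq`. -/
def terminalVoltage {N : ℕ} (g : Fin N → IBR) (x : (n : Fin N) → Fin (g n).dim → ℝ) :
    Fin N → Fin 2 → ℝ :=
  fun n => (g n).T *ᵥ ((g n).C *ᵥ x n)

/-- The closed-loop vector field. The IBRs are driven by `i_oDQ = -i_sDQ`, which is rotated
into their own frames by `i_odq = T⁻¹ i_oDQ`, and their terminal voltages drive the network. -/
def closedLoop {N M : ℕ} (g : Fin N → IBR) (net : RLNetwork N M) :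
    MicrogridState M g → MicrogridState M g :=
  fun s =>
    (fun n => (g n).A *ᵥ s.1 n + (g n).B *ᵥ ((g n).T⁻¹ *ᵥ (-net.nodalCurrent s.2 n)),
      net.branchDynamics s.2 (terminalVoltage g s.1))

/-- The stability protocol: every IBR, from `Δi_odq` to `Δv_odq`, is output feedback passive. -/
def FollowsProtocol {N : ℕ} (g : Fin N → IBR) : Prop :=
  ∀ n, IsOFP (g n).inputOutput

end

/-! ### Linear differential equations on finite-dimensional spaces -/

section LinearODE

/-! The closed loop is linear and finite-dimensional, so it suffices to exclude modes `α + β i` with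
`0 ≤ α` (`isAsymptoticallyStableOrigin_of_modes`). Let `a`, `b` be the real and imaginary parts of
such a mode.

Passivity speaks only of zero initial states and square integrable inputs, whereas the mode starts
away from the origin and need not decay. Stabilizability bridges the gap. On each resource the mode
is a forced mode `A w + B u = z w`, and the Hautus condition makes its real and imaginary parts
reachable from the origin (`IBR.mem_reachableSubmodule_of_mode`). Steering from zero to the initial
state, following the mode up to time `T` and then switching the input off turns OFP into a
dissipation inequality along the mode, with a constant independent of `T`
(`IBR.exists_storage_bound`).

The interconnection preserves power: rotations are orthogonal, the two network maps are `C₀` and its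
transpose, and the `ω₀` terms do no work. Adding the magnetic energy of the branches therefore
cancels all exchanged power and bounds the integral of `dissipation`
(`exists_integral_dissipation_le`). Along the real and imaginary solutions together, the dissipation
is `exp (2 α t)` times its initial value `Q`, hence at least `Q` if `Q > 0`. A bounded integral thus
forces `Q ≤ 0`, also when `α = 0`. Positivity of `σ n` and `r m` then makes all outputs `C x` and
all branch currents vanish, so the resources have zero input, and what remains is an unobservable
mode of each `A`, excluded by detectability. -/

theorem exp_smul_apply_of_pow_apply_eq_zero {V : Type*} [NormedAddCommGroup V] [NormedSpace ℂ V]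
    [CompleteSpace V] (N : V →L[ℂ] V) (v : V) (K : ℕ) (h : (N ^ K) v = 0) (t : ℂ) :
    NormedSpace.exp (t • N) v =
      ∑ k ∈ Finset.range K, ((k.factorial : ℂ)⁻¹ * t ^ k) • (N ^ k) v := by
  have hs := NormedSpace.exp_series_hasSum_exp' (𝕂 := ℂ) (t • N)
  have hs' := hs.mapL (ContinuousLinearMap.apply ℂ V v)
  have hz : ∀ k ∉ Finset.range K, (ContinuousLinearMap.apply ℂ V v)
      (((k.factorial : ℂ)⁻¹) • (t • N) ^ k) = 0 := by
    intro k hk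
    have hk' : K ≤ k := by simpa using hk
    obtain ⟨j, rfl⟩ := Nat.exists_eq_add_of_le' hk'
    simp [smul_pow, pow_add, h]
  have := hs'.unique (hasSum_sum_of_ne_finset_zero hz)
  simpa [smul_pow, smul_smul] using this

/-- With `f = μ + N` the flow on a generalized eigenvector is `exp (t μ)` times a polynomial in `t`,
and the exponential wins. -/
theorem tendsto_exp_smul_apply_of_pow_apply_eq_zero {V : Type*} [NormedAddCommGroup V]
    [NormedSpace ℂ V] [CompleteSpace V] (f : V →L[ℂ] V) (μ : ℂ) (hμ : μ.re < 0) (v : V) (K : ℕ)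
    (h : ((f - μ • 1) ^ K) v = 0) :
    Filter.Tendsto (fun t : ℝ => NormedSpace.exp ((t : ℂ) • f) v) Filter.atTop (nhds 0) := by
  set N := f - μ • 1 with hN
  have key : ∀ t : ℝ, NormedSpace.exp ((t : ℂ) • f) v =
      ∑ k ∈ Finset.range K, (Complex.exp (t * μ) * ((k.factorial : ℂ)⁻¹ * (t : ℂ) ^ k)) •
        (N ^ k) v := by
    intro t
    have hf : (t : ℂ) • f = algebraMap ℂ (V →L[ℂ] V) (t * μ) + (t : ℂ) • N := by
      rw [hN, Algebra.algebraMap_eq_smul_one, smul_sub, smul_smul]; abel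
    let +nondep : NormedAlgebra ℚ (V →L[ℂ] V) := .restrictScalars ℚ ℂ _
    rw [hf, NormedSpace.exp_add_of_commute (Algebra.commutes _ _),
      ← NormedSpace.algebraMap_exp_comm, Algebra.algebraMap_eq_smul_one]
    simp only [smul_apply, smul_mul_assoc, one_mul]
    rw [exp_smul_apply_of_pow_apply_eq_zero N v K h, Finset.smul_sum, Complex.exp_eq_exp_ℂ]
    simp only [smul_smul]
  simp only [key]
  rw [show (0 : V) = ∑ k ∈ Finset.range K, (0 : V) by simp]
  refine tendsto_finsetSum _ fun k _ => ?_
  rw [show (0 : V) = (0 : ℂ) • (N ^ k) v by simp]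
  refine Filter.Tendsto.smul_const ?_ _
  rw [tendsto_zero_iff_norm_tendsto_zero]
  have h1 := tendsto_rpow_mul_exp_neg_mul_atTop_nhds_zero k (-μ.re) (by linarith)
  have h2 := h1.const_mul ((k.factorial : ℝ)⁻¹)
  rw [mul_zero] at h2
  refine h2.congr' ?_
  filter_upwards [Filter.eventually_ge_atTop 0] with t ht
  simp [Complex.norm_exp, abs_of_nonneg ht]
  ring_nf

/-- If all eigenvalues of a complex linear map have negative real part, its flow tends to zero. -/
theorem tendsto_exp_smul_apply {V : Type*} [NormedAddCommGroup V] [NormedSpace ℂ V]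
    [FiniteDimensional ℂ V] (f : V →L[ℂ] V)
    (hf : ∀ (μ : ℂ) (v : V), 0 ≤ μ.re → f v = μ • v → v = 0) (v : V) :
    Filter.Tendsto (fun t : ℝ => NormedSpace.exp ((t : ℂ) • f) v) Filter.atTop (nhds 0) := by
  have : CompleteSpace V := FiniteDimensional.complete ℂ V
  have hv : v ∈ ⨆ μ, Module.End.maxGenEigenspace (f : V →ₗ[ℂ] V) μ := by
    rw [Module.End.iSup_maxGenEigenspace_eq_top]; trivial
  induction hv using Submodule.iSup_induction' with
  | mem μ x hx =>
    rw [Module.End.mem_maxGenEigenspace] at hx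
    obtain ⟨K, hK⟩ := hx
    have hpow : ∀ (k : ℕ) (y : V),
        ((f - μ • 1) ^ k) y = (((f : Module.End ℂ V) - μ • 1) ^ k) y := by
      intro k
      induction k with
      | zero => intro y; simp
      | succ k ih => intro y; rw [pow_succ, pow_succ]; simp [ih]
    by_cases hμ : μ.re < 0
    · exact tendsto_exp_smul_apply_of_pow_apply_eq_zero f μ hμ x K (by rw [hpow, hK])
    -- For `0 ≤ μ.re` the map `f - μ` is injective, hence so are its powers, and the generalized
    -- eigenspace is trivial.
    · have hx0 : ∀ (k : ℕ) (y : V), ((f - μ • 1) ^ k) y = 0 → y = 0 := by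
        intro k
        induction k with
        | zero => intro y hy; simpa using hy
        | succ k ih =>
          intro y hy
          rw [pow_succ] at hy
          have := ih _ hy
          refine hf μ y (not_lt.mp hμ) ?_
          simpa [sub_eq_zero] using this
      have := hx0 K x (by rw [hpow, hK])
      subst this
      simp
  | zero => simp
  | add x y _ _ hx hy => simpa using hx.add hy

theorem hasDerivAt_exp_ofReal_smul_apply {V : Type*} [NormedAddCommGroup V] [NormedSpace ℂ V]
    [CompleteSpace V] (f : V →L[ℂ] V) (v : V) (t : ℝ) :
    HasDerivAt (fun t : ℝ => NormedSpace.exp ((t : ℂ) • f) v)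
      (f (NormedSpace.exp ((t : ℂ) • f) v)) t := by
  have h := (hasDerivAt_exp_smul_const' (𝕂 := ℂ) f (t : ℂ)).scomp t Complex.ofRealCLM.hasDerivAt
  simp only [Complex.ofRealCLM_apply, Complex.ofReal_one, one_smul] at h
  exact ((ContinuousLinearMap.apply ℂ V v).restrictScalars ℝ).hasFDerivAt.comp_hasDerivAt t h

/-- Solutions of a linear differential equation are determined by their initial value. -/
theorem IsSolution.eq_of_initial {E : Type*} [NormedAddCommGroup E] [NormedSpace ℝ E]
    (f : E →L[ℝ] E) {x y : ℝ → E} (hx : IsSolution f x) (hy : IsSolution f y) (h : x 0 = y 0)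
    {t : ℝ} (ht : 0 ≤ t) : x t = y t := by
  refine ODE_solution_unique (v := fun _ => f) (K := ‖f‖₊) (fun _ => f.lipschitz)
    (fun s hs => ((hx s hs.1).continuousWithinAt).mono fun r hr => hr.1)
    (fun s hs => (hx s hs.1).mono fun r hr => hs.1.trans hr)
    (fun s hs => ((hy s hs.1).continuousWithinAt).mono fun r hr => hr.1)
    (fun s hs => (hy s hs.1).mono fun r hr => hs.1.trans hr) h ⟨ht, le_rfl⟩

variable {E : Type*} [NormedAddCommGroup E] [NormedSpace ℝ E] [FiniteDimensional ℝ E]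

/-- If a real linear map has no mode with nonnegative real part (`a + b i` being an eigenvector of
the complexification for the eigenvalue `α + β i`), each initial state has a decaying solution. -/
theorem exists_isSolution_tendsto_zero (f : E →ₗ[ℝ] E)
    (hf : ∀ (α β : ℝ) (a b : E), 0 ≤ α → f a = α • a - β • b → f b = β • a + α • b →
      a = 0 ∧ b = 0) (v : E) :
    ∃ x : ℝ → E, IsSolution f x ∧ x 0 = v ∧ Filter.Tendsto x Filter.atTop (nhds 0) := by
  let B := Module.finBasis ℝ E
  let n := Module.finrank ℝ E
  let A : Matrix (Fin n) (Fin n) ℝ := LinearMap.toMatrix B B f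
  let F : (Fin n → ℂ) →L[ℂ] (Fin n → ℂ) :=
    LinearMap.toContinuousLinearMap (Matrix.toLin' (A.map Complex.ofReal))
  have hF : ∀ w : Fin n → ℂ, F w = A.map Complex.ofReal *ᵥ w := fun w => by
    simp [F]
  have hre : ∀ w : Fin n → ℂ, (fun i => (F w i).re) = A *ᵥ fun i => (w i).re := by
    intro w; ext i; simp [hF, Matrix.mulVec, dotProduct]
  have him : ∀ w : Fin n → ℂ, (fun i => (F w i).im) = A *ᵥ fun i => (w i).im := by
    intro w; ext i; simp [hF, Matrix.mulVec, dotProduct]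
  have hA : ∀ c : Fin n → ℝ, B.equivFun.symm (A *ᵥ c) = f (B.equivFun.symm c) := by
    intro c
    apply B.equivFun.injective
    rw [LinearEquiv.apply_symm_apply]
    have := LinearMap.toMatrix_mulVec_repr B B f (B.equivFun.symm c)
    rw [← Module.Basis.equivFun_apply, ← Module.Basis.equivFun_apply,
      LinearEquiv.apply_symm_apply] at this
    exact this
  have hstable : ∀ (μ : ℂ) (w : Fin n → ℂ), 0 ≤ μ.re → F w = μ • w → w = 0 := by
    intro μ w hμ hw
    have h1 := hre w
    have h2 := him w
    rw [hw] at h1 h2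
    have h3 := hf μ.re μ.im (B.equivFun.symm fun i => (w i).re)
      (B.equivFun.symm fun i => (w i).im) hμ
      (by rw [← hA, ← h1, ← map_smul, ← map_smul, ← map_sub]; congr 1)
      (by rw [← hA, ← h2, ← map_smul, ← map_smul, ← map_add]; congr 1; ext i; simp; ring)
    rw [LinearEquiv.map_eq_zero_iff, LinearEquiv.map_eq_zero_iff] at h3
    ext i
    exact Complex.ext (congrFun h3.1 i) (congrFun h3.2 i)
  let w₀ : Fin n → ℂ := fun i => (B.equivFun v i : ℂ)
  -- Taking real parts intertwines the complexified map with `f`, because the matrix is real. It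
  -- therefore carries the decaying complex flow to a real solution.
  let P : (Fin n → ℂ) →ₗ[ℝ] E :=
    { toFun := fun w => B.equivFun.symm fun i => (w i).re
      map_add' := fun w w' => by rw [← map_add]; congr 1
      map_smul' := fun c w => by rw [← map_smul]; congr 1; ext i; simp }
  have hP : ∀ w, P (F w) = f (P w) := by
    intro w
    change B.equivFun.symm (fun i => (F w i).re) = _
    rw [hre, hA]; rfl
  let P' := LinearMap.toContinuousLinearMap P
  refine ⟨fun t => P' (NormedSpace.exp ((t : ℂ) • F) w₀), ?_, ?_, ?_⟩
  · intro t _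
    have h1 := hasDerivAt_exp_ofReal_smul_apply F w₀ t
    have h2 := P'.hasFDerivAt.comp_hasDerivAt t h1
    have h3 : P' (F (NormedSpace.exp ((t : ℂ) • F) w₀)) =
        f (P' (NormedSpace.exp ((t : ℂ) • F) w₀)) := hP _
    rw [← h3]
    exact h2.hasDerivWithinAt
  · beta_reduce
    have h0 : ((0 : ℝ) : ℂ) • F = 0 := by rw [Complex.ofReal_zero]; exact zero_smul ℂ F
    rw [h0, NormedSpace.exp_zero, one_apply_eq_self]
    change B.equivFun.symm (fun i => (w₀ i).re) = v
    simp [w₀]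
  · have := (P'.continuous.tendsto 0).comp (tendsto_exp_smul_apply F hstable w₀)
    rwa [map_zero] at this

/-- A linear system without modes of nonnegative real part is asymptotically stable. -/
theorem isAsymptoticallyStableOrigin_of_modes (f : E →ₗ[ℝ] E)
    (hf : ∀ (α β : ℝ) (a b : E), 0 ≤ α → f a = α • a - β • b → f b = β • a + α • b →
      a = 0 ∧ b = 0) :
    IsAsymptoticallyStableOrigin f := by
  let B := Module.finBasis ℝ E
  -- By uniqueness every solution is a fixed combination of the decaying solutions that start at the
  -- basis vectors. Bounds on these finitely many give stability, and their limits give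
  -- attractivity.
  choose y hy hy0 hylim using fun i => exists_isSolution_tendsto_zero f hf (B i)
  have hrep : ∀ x : ℝ → E, IsSolution f x → ∀ t : ℝ, 0 ≤ t →
      x t = ∑ i, B.equivFun (x 0) i • y i t := by
    intro x hx t ht
    refine IsSolution.eq_of_initial (LinearMap.toContinuousLinearMap f)
      (y := fun t => ∑ i, B.equivFun (x 0) i • y i t) hx ?_ ?_ ht
    · intro s hs
      have : HasDerivWithinAt (fun t => ∑ i, B.equivFun (x 0) i • y i t)
          (∑ i, B.equivFun (x 0) i • f (y i s)) (Set.Ici 0) s :=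
        HasDerivWithinAt.fun_sum fun i _ => (hy i s hs).const_smul _
      simpa using this
    · simp only [hy0]
      exact (B.sum_equivFun (x 0)).symm
  have hbdd : ∀ i, ∃ C, 0 ≤ C ∧ ∀ t, 0 ≤ t → ‖y i t‖ ≤ C := by
    intro i
    obtain ⟨R, hR⟩ := Filter.eventually_atTop.mp
      ((hylim i).norm.eventually (gt_mem_nhds (by simp : ‖(0 : E)‖ < 1)))
    have hc : ContinuousOn (y i) (Set.Icc 0 R) := fun s hs =>
      ((hy i s hs.1).continuousWithinAt).mono fun r hr => hr.1
    obtain ⟨C, hC⟩ := isCompact_Icc.exists_bound_of_continuousOn hc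
    refine ⟨max 1 C, le_trans zero_le_one (le_max_left _ _), fun t ht => ?_⟩
    rcases le_total t R with h | h
    · exact (hC t ⟨ht, h⟩).trans (le_max_right _ _)
    · exact (hR t h).le.trans (le_max_left _ _)
  choose C hC0 hC using hbdd
  refine ⟨map_zero f, fun ε hε => ?_, 1, one_pos, fun x hx _ => ?_⟩
  · have hcont : Continuous fun v : E => ∑ i, ‖B.equivFun v i‖ * C i := by
      have : Continuous B.equivFun := B.equivFun.toLinearMap.continuous_of_finiteDimensional
      fun_prop
    obtain ⟨ρ, hρ, H⟩ := Metric.eventually_nhds_iff.mp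
      ((hcont.tendsto 0).eventually_lt_const (u := ε) (by simpa using hε))
    refine ⟨ρ, hρ, fun x hx hx0 t ht => lt_of_le_of_lt ?_ (H (y := x 0) (by simpa using hx0))⟩
    rw [hrep x hx t ht]
    refine (norm_sum_le _ _).trans (Finset.sum_le_sum fun i _ => ?_)
    rw [norm_smul]
    exact mul_le_mul_of_nonneg_left (hC i t ht) (norm_nonneg _)
  · have : Filter.Tendsto (fun t => ∑ i, B.equivFun (x 0) i • y i t) Filter.atTop (nhds 0) := by
      rw [show (0 : E) = ∑ i, B.equivFun (x 0) i • (0 : E) by simp]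
      exact tendsto_finsetSum _ fun i _ => (hylim i).const_smul _
    refine this.congr' ?_
    filter_upwards [Filter.eventually_ge_atTop 0] with t ht
    exact (hrep x hx t ht).symm

end LinearODE

/-! ### Reachability -/

section Reachability

variable {E : Type*} [NormedAddCommGroup E] [NormedSpace ℝ E] {m : ℕ}

/-- `x` is a trajectory of `ẋ = A x + B u` on the whole time axis for the continuous input `u`. -/
def IsTrajectory (A : E →L[ℝ] E) (B : (Fin m → ℝ) →L[ℝ] E) (u : ℝ → Fin m → ℝ) (x : ℝ → E) :
    Prop :=
  Continuous u ∧ ∀ t, HasDerivAt x (A (x t) + B (u t)) t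

theorem IsTrajectory.continuous {A : E →L[ℝ] E} {B : (Fin m → ℝ) →L[ℝ] E} {u : ℝ → Fin m → ℝ}
    {x : ℝ → E} (h : IsTrajectory A B u x) : Continuous x :=
  continuous_iff_continuousAt.mpr fun t => (h.2 t).continuousAt

/-- The states that can be reached from the origin at time `1`. -/
def reachableSubmodule (A : E →L[ℝ] E) (B : (Fin m → ℝ) →L[ℝ] E) : Submodule ℝ E where
  carrier := {z | ∃ u x, IsTrajectory A B u x ∧ x 0 = 0 ∧ x 1 = z}
  zero_mem' := ⟨0, 0, ⟨continuous_zero, fun t => by simp⟩, rfl, rfl⟩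
  add_mem' := by
    rintro _ _ ⟨u, x, ⟨hu, hx⟩, h0, rfl⟩ ⟨u', x', ⟨hu', hx'⟩, h0', rfl⟩
    refine ⟨u + u', x + x', ⟨hu.add hu', fun t => ?_⟩, by simp [h0, h0'], rfl⟩
    convert (hx t).add (hx' t) using 1
    simp only [Pi.add_apply, map_add]
    abel
  smul_mem' := by
    rintro c _ ⟨u, x, ⟨hu, hx⟩, h0, rfl⟩
    refine ⟨c • u, c • x, ⟨hu.const_smul c, fun t => ?_⟩, by simp [h0], rfl⟩
    convert (hx t).const_smul c using 1
    simp

theorem exp_smul_mul_exp_neg_smul [CompleteSpace E] (A : E →L[ℝ] E) (t : ℝ) :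
    NormedSpace.exp (t • A) * NormedSpace.exp ((-t) • A) = 1 := by
  let +nondep : NormedAlgebra ℚ (E →L[ℝ] E) := .restrictScalars ℚ ℝ _
  rw [← NormedSpace.exp_add_of_commute]
  · rw [← add_smul, add_neg_cancel, zero_smul, NormedSpace.exp_zero]
  · exact ((Commute.refl A).smul_left t).smul_right (-t)

/-- Variation of constants. -/
theorem exists_isTrajectory [CompleteSpace E] (A : E →L[ℝ] E) (B : (Fin m → ℝ) →L[ℝ] E) {u : ℝ → Fin m → ℝ}
    (hu : Continuous u) : ∃ x, IsTrajectory A B u x ∧ x 0 = 0 := by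
  have hexp : Continuous fun s : ℝ => NormedSpace.exp ((-s) • A) := by
    have : Continuous fun s : ℝ => NormedSpace.exp (s • A) :=
      continuous_iff_continuousAt.mpr fun t => (hasDerivAt_exp_smul_const (𝕂 := ℝ) A t).continuousAt
    exact this.comp continuous_neg
  have hg : Continuous fun s : ℝ => NormedSpace.exp ((-s) • A) (B (u s)) :=
    hexp.clm_apply (B.continuous.comp hu)
  refine ⟨fun t => NormedSpace.exp (t • A)
    (∫ s in (0 : ℝ)..t, NormedSpace.exp ((-s) • A) (B (u s))), ⟨hu, fun t => ?_⟩, by simp⟩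
  have h1 := hasDerivAt_exp_smul_const' (𝕂 := ℝ) A t
  have h2 := hg.integral_hasStrictDerivAt 0 t
  have h3 := h1.clm_apply h2.hasDerivAt
  convert h3 using 1
  have := congrArg (fun T : E →L[ℝ] E => T (B (u t))) (exp_smul_mul_exp_neg_smul A t)
  change NormedSpace.exp (t • A) (NormedSpace.exp ((-t) • A) (B (u t))) = B (u t) at this
  rw [this]
  rfl

/-- A functional that vanishes on the reachable states annihilates the controllability matrix. -/
theorem apply_pow_apply_eq_zero_of_reachable [CompleteSpace E] (A : E →L[ℝ] E) (B : (Fin m → ℝ) →L[ℝ] E)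
    (f : E →L[ℝ] ℝ) (hf : ∀ z ∈ reachableSubmodule A B, f z = 0) (k : ℕ) (c : Fin m → ℝ) :
    f ((A ^ k) (B c)) = 0 := by
  have hderiv : ∀ t : ℝ, HasDerivAt (fun t : ℝ => NormedSpace.exp (t • A))
      (NormedSpace.exp (t • A) * A) t := fun t => hasDerivAt_exp_smul_const (𝕂 := ℝ) A t
  have hexp : Continuous fun s : ℝ => NormedSpace.exp (s • A) :=
    continuous_iff_continuousAt.mpr fun t => (hderiv t).continuousAt
  have hexp1 : Continuous fun s : ℝ => NormedSpace.exp ((1 - s) • A) :=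
    hexp.comp (by fun_prop)
  -- This is the adjoint input `Bᵀ exp ((1 - t) Aᵀ) f`. With it, `φ` below has derivative `|u|²`;
  -- since `φ` vanishes at both ends, `u` vanishes on the open unit interval.
  let u : ℝ → Fin m → ℝ := fun t j => f (NormedSpace.exp ((1 - t) • A) (B (Pi.single j 1)))
  have hu : Continuous u := by
    refine continuous_pi fun j => f.continuous.comp (hexp1.clm_apply continuous_const)
  have hexpand : ∀ (t : ℝ) (c : Fin m → ℝ),
      f (NormedSpace.exp ((1 - t) • A) (B c)) = ∑ j, c j * u t j := by
    intro t c
    have hc : c = ∑ j, c j • (Pi.single j 1 : Fin m → ℝ) := by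
      ext i; simp [Finset.sum_apply, Pi.single_apply]
    conv_lhs => rw [hc]
    simp [u]
  obtain ⟨x, hx, hx0⟩ := exists_isTrajectory A B hu
  let φ : ℝ → ℝ := fun t => f (NormedSpace.exp ((1 - t) • A) (x t))
  have hφ : ∀ t, HasDerivAt φ (∑ j, u t j * u t j) t := by
    intro t
    have h1 : HasDerivAt (fun t : ℝ => NormedSpace.exp ((1 - t) • A))
        (-(NormedSpace.exp ((1 - t) • A) * A)) t := by
      have := (hderiv (1 - t)).scomp t ((hasDerivAt_id t).const_sub 1)
      simpa [Function.comp_def] using! this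
    have h2 := f.hasFDerivAt.comp_hasDerivAt t (h1.clm_apply (hx.2 t))
    refine h2.congr_deriv ?_
    rw [← hexpand]
    simp
  have hmono : Monotone φ := monotone_of_deriv_nonneg (fun t => (hφ t).differentiableAt) fun t => by
    rw [(hφ t).deriv]
    exact Finset.sum_nonneg fun j _ => mul_self_nonneg _
  have hφ0 : φ 0 = 0 := by simp [φ, hx0]
  have hφ1 : φ 1 = 0 := by
    simpa [φ] using hf (x 1) ⟨u, x, hx, hx0, rfl⟩
  have hu0 : ∀ t ∈ Set.Ioo (0 : ℝ) 1, ∀ j, u t j = 0 := by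
    intro t ht
    have hev : φ =ᶠ[nhds t] fun _ => 0 := by
      filter_upwards [Ioo_mem_nhds ht.1 ht.2] with s hs
      exact le_antisymm (hφ1 ▸ hmono hs.2.le) (hφ0 ▸ hmono hs.1.le)
    have h := (hφ t).unique ((hasDerivAt_const t (0 : ℝ)).congr_of_eventuallyEq hev)
    intro j
    have := (Finset.sum_eq_zero_iff_of_nonneg fun j _ => mul_self_nonneg (u t j)).mp h j
      (Finset.mem_univ j)
    exact mul_self_eq_zero.mp this
  -- Each differentiation in `s` brings down one factor `A`; continuity then allows `s = 0`, which
  -- lies only in the closure of the interval.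
  have hzero : ∀ k : ℕ, ∀ s ∈ Set.Ioo (0 : ℝ) 1,
      f (NormedSpace.exp (s • A) ((A ^ k) (B c))) = 0 := by
    intro k
    induction k with
    | zero =>
      intro s hs
      have := hexpand (1 - s) c
      rw [sub_sub_cancel] at this
      rw [pow_zero, one_apply_eq_self, this]
      exact Finset.sum_eq_zero fun j _ => by
        rw [hu0 (1 - s) ⟨by linarith [hs.2], by linarith [hs.1]⟩, mul_zero]
    | succ k ih =>
      intro s hs
      have hev : (fun s : ℝ => f (NormedSpace.exp (s • A) ((A ^ k) (B c)))) =ᶠ[nhds s]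
          fun _ => 0 := by
        filter_upwards [Ioo_mem_nhds hs.1 hs.2] with r hr using ih r hr
      have h1 := f.hasFDerivAt.comp_hasDerivAt s
        ((hderiv s).clm_apply (hasDerivAt_const s ((A ^ k) (B c))))
      have h := h1.unique ((hasDerivAt_const s (0 : ℝ)).congr_of_eventuallyEq hev)
      simpa [pow_succ'] using h
  have hclosed : Set.EqOn (fun s : ℝ => f (NormedSpace.exp (s • A) ((A ^ k) (B c))))
      (fun _ => 0) (closure (Set.Ioo (0 : ℝ) 1)) :=
    Set.EqOn.closure (hzero k) (f.continuous.comp (hexp.clm_apply continuous_const))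
      continuous_const
  have := hclosed (x := 0) (by rw [closure_Ioo (by norm_num)]; simp)
  simpa using this

end Reachability

/-! ### Hautus test: reachability of forced modes -/

section Hautus

/-- If no mode `z` with `0 ≤ re z` is uncontrollable, a forced mode `A w + B u = z w` is orthogonal
to everything that annihilates the controllability matrix. -/
theorem dotProduct_eq_zero_of_hautus {d m : ℕ} (A : Matrix (Fin d) (Fin d) ℂ)
    (B : Matrix (Fin d) (Fin m) ℂ) (z : ℂ)
    (hstab : ∀ w : Fin d → ℂ, w ᵥ* A = z • w → w ᵥ* B = 0 → w = 0)
    (w : Fin d → ℂ) (u : Fin m → ℂ) (hw : A *ᵥ w + B *ᵥ u = z • w)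
    (η : Fin d → ℂ) (hη : ∀ k : ℕ, η ᵥ* (A ^ k * B) = 0) : η ⬝ᵥ w = 0 := by
  -- `K` is invariant under right multiplication by `A`. By the Hautus condition `ξ ↦ ξ A - z ξ` is
  -- injective on `K`, hence onto, so `η = ξ A - z ξ` with `ξ` in `K`. Then `η ⬝ᵥ w = ξ ⬝ᵥ (A w - z
  -- w) = -ξ ⬝ᵥ B u = 0`.
  let K : Submodule ℂ (Fin d → ℂ) :=
    { carrier := {η | ∀ k : ℕ, η ᵥ* (A ^ k * B) = 0}
      zero_mem' := fun k => Matrix.zero_vecMul _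
      add_mem' := fun {a b} ha hb k => by rw [Matrix.add_vecMul, ha k, hb k, add_zero]
      smul_mem' := fun c a ha k => by rw [Matrix.smul_vecMul, ha k, smul_zero] }
  let F : (Fin d → ℂ) →ₗ[ℂ] (Fin d → ℂ) := A.vecMulLinear - z • LinearMap.id
  have hFapp : ∀ ξ, F ξ = ξ ᵥ* A - z • ξ := fun ξ => rfl
  have hF : ∀ ξ ∈ K, F ξ ∈ K := by
    intro ξ hξ
    refine K.sub_mem (fun k => ?_) (K.smul_mem z hξ)
    change (ξ ᵥ* A) ᵥ* (A ^ k * B) = 0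
    rw [Matrix.vecMul_vecMul, ← Matrix.mul_assoc, ← pow_succ']
    exact hξ (k + 1)
  have hinj : Function.Injective (F.restrict hF) := by
    rw [← LinearMap.ker_eq_bot, LinearMap.ker_eq_bot']
    rintro ⟨ξ, hξ⟩ h
    have h' : ξ ᵥ* A - z • ξ = 0 := congrArg Subtype.val h
    have h0 := hξ 0
    rw [pow_zero, Matrix.one_mul] at h0
    exact Subtype.ext (hstab ξ (sub_eq_zero.mp h') h0)
  obtain ⟨⟨ξ, hξ⟩, h⟩ := LinearMap.injective_iff_surjective.mp hinj ⟨η, hη⟩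
  have h' : ξ ᵥ* A - z • ξ = η := congrArg Subtype.val h
  have h0 := hξ 0
  rw [pow_zero, Matrix.one_mul] at h0
  have h1 : ξ ⬝ᵥ (B *ᵥ u) = 0 := by rw [Matrix.dotProduct_mulVec, h0, zero_dotProduct]
  rw [← h', sub_dotProduct, ← Matrix.dotProduct_mulVec, eq_sub_of_add_eq hw, dotProduct_sub, h1,
    smul_dotProduct, dotProduct_smul]
  simp

/-- The continuous linear map of a real matrix. -/
noncomputable def Matrix.mulVecCLM {d m : ℕ} (A : Matrix (Fin d) (Fin m) ℝ) : (Fin m → ℝ) →L[ℝ] (Fin d → ℝ) :=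
  LinearMap.toContinuousLinearMap A.mulVecLin

@[simp]
theorem Matrix.mulVecCLM_apply {d m : ℕ} (A : Matrix (Fin d) (Fin m) ℝ) (v : Fin m → ℝ) :
    A.mulVecCLM v = A *ᵥ v := rfl

theorem Matrix.mulVecCLM_pow_apply {d : ℕ} (A : Matrix (Fin d) (Fin d) ℝ) (k : ℕ)
    (v : Fin d → ℝ) : (A.mulVecCLM ^ k) v = (A ^ k) *ᵥ v := by
  induction k with
  | zero => simp
  | succ k ih => rw [pow_succ', pow_succ', ← Matrix.mulVec_mulVec, ← ih]; rfl

/-- Real and imaginary part of the complexified action of a real matrix. -/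
theorem Matrix.map_ofReal_mulVec {d m : ℕ} (A : Matrix (Fin d) (Fin m) ℝ) (a b : Fin m → ℝ) :
    (A.map Complex.ofReal *ᵥ fun i => (⟨a i, b i⟩ : ℂ)) =
      fun i => ⟨(A *ᵥ a) i, (A *ᵥ b) i⟩ := by
  ext i
  apply Complex.ext <;> simp [Matrix.mulVec, dotProduct]

/-- The real and imaginary part of a forced mode with nonnegative real part of a stabilizable
system are reachable. -/
theorem IBR.mem_reachableSubmodule_of_mode (g : IBR) (hstab : g.IsStabilizable) (α β : ℝ)
    (hα : 0 ≤ α) (a b : Fin g.dim → ℝ) (p q : Fin 2 → ℝ)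
    (ha : g.A *ᵥ a + g.B *ᵥ p = α • a - β • b) (hb : g.A *ᵥ b + g.B *ᵥ q = β • a + α • b) :
    a ∈ reachableSubmodule g.A.mulVecCLM g.B.mulVecCLM ∧
      b ∈ reachableSubmodule g.A.mulVecCLM g.B.mulVecCLM := by
  let S := reachableSubmodule g.A.mulVecCLM g.B.mulVecCLM
  -- Membership in a subspace is tested by the functionals that vanish on it.
  have key : ∀ f : (Fin g.dim → ℝ) →ₗ[ℝ] ℝ, S ≤ LinearMap.ker f → f a = 0 ∧ f b = 0 := by
    intro f hf
    let η : Fin g.dim → ℝ := fun i => f (Pi.single i 1)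
    have hfη : ∀ v, f v = η ⬝ᵥ v := by
      intro v
      have hv : v = ∑ i, v i • (Pi.single i 1 : Fin g.dim → ℝ) := by
        ext i; simp [Finset.sum_apply, Pi.single_apply]
      conv_lhs => rw [hv]
      simp [dotProduct, η, mul_comm]
    have hkill := apply_pow_apply_eq_zero_of_reachable g.A.mulVecCLM g.B.mulVecCLM
      (LinearMap.toContinuousLinearMap f) fun z hz => hf hz
    have hη : ∀ k : ℕ, η ᵥ* (g.A ^ k * g.B) = 0 := by
      intro k
      ext j
      have h := hkill k (Pi.single j 1)
      rw [Matrix.mulVecCLM_pow_apply, Matrix.mulVecCLM_apply, Matrix.mulVec_mulVec] at h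
      change f _ = 0 at h
      rw [hfη, Matrix.dotProduct_mulVec] at h
      simpa using h
    have hηC : ∀ k : ℕ, (fun i => (η i : ℂ)) ᵥ*
        ((g.A.map Complex.ofReal) ^ k * g.B.map Complex.ofReal) = 0 := by
      intro k
      have h1 : (g.A.map Complex.ofReal) ^ k * g.B.map Complex.ofReal =
          (g.A ^ k * g.B).map Complex.ofReal := by
        have h2 := Matrix.map_pow g.A Complex.ofRealHom k
        have h3 := Matrix.map_mul (L := g.A ^ k) (M := g.B) (f := Complex.ofRealHom)
        rw [h2] at h3
        exact h3.symm
      rw [h1]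
      ext j
      have h := congrFun (hη k) j
      simp only [Matrix.vecMul, dotProduct, Matrix.map_apply, Pi.zero_apply] at h ⊢
      exact_mod_cast h
    have h := dotProduct_eq_zero_of_hautus (g.A.map Complex.ofReal) (g.B.map Complex.ofReal)
      ⟨α, β⟩ (fun w => hstab ⟨α, β⟩ hα w) (fun i => ⟨a i, b i⟩) (fun i => ⟨p i, q i⟩) (by
        rw [Matrix.map_ofReal_mulVec, Matrix.map_ofReal_mulVec]
        ext i
        have h1 := congrFun ha i
        have h2 := congrFun hb i
        simp only [Pi.add_apply, Pi.sub_apply, Pi.smul_apply, smul_eq_mul] at h1 h2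
        apply Complex.ext
        · simpa using h1
        · simp only [Pi.add_apply, Pi.smul_apply, Complex.add_im, smul_eq_mul, Complex.mul_im]
          linarith) _ hηC
    rw [hfη, hfη]
    constructor
    · simpa [dotProduct] using congrArg Complex.re h
    · simpa [dotProduct] using congrArg Complex.im h
  constructor
  · by_contra hc
    obtain ⟨f, hfa, hf⟩ := Submodule.exists_le_ker_of_notMem hc
    exact hfa (key f hf).1
  · by_contra hc
    obtain ⟨f, hfb, hf⟩ := Submodule.exists_le_ker_of_notMem hc
    exact hfb (key f hf).2

end Hautus

/-! ### Passivity along trajectories that start in a reachable state -/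

section Dissipation

open MeasureTheory

theorem memLp_indicator_Ioc_of_continuous {F : Type*} [NormedAddCommGroup F]
    [SecondCountableTopology F] [MeasurableSpace F] [BorelSpace F] {u : ℝ → F}
    (hu : Continuous u) (a b : ℝ) (p : ENNReal) :
    MemLp ((Set.Ioc a b).indicator u) p volume := by
  rw [memLp_indicator_iff_restrict measurableSet_Ioc]
  obtain ⟨C, hC⟩ := (isCompact_Icc (a := a) (b := b)).exists_bound_of_continuousOn hu.continuousOn
  refine MemLp.of_bound hu.aestronglyMeasurable C ?_
  filter_upwards [ae_restrict_mem measurableSet_Ioc] with x hx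
  exact hC x ⟨hx.1.le, hx.2⟩

theorem hasDerivAt_ite_le {E : Type*} [NormedAddCommGroup E] [NormedSpace ℝ E] {c t : ℝ}
    (hct : t ≠ c) {x y : ℝ → E} {x' y' : E} (hx : HasDerivAt x x' t) (hy : HasDerivAt y y' t) :
    HasDerivAt (fun s => if s ≤ c then x s else y s) (if t ≤ c then x' else y') t := by
  rcases lt_or_gt_of_ne hct with h | h
  · rw [if_pos h.le]
    refine hx.congr_of_eventuallyEq ?_
    filter_upwards [Iio_mem_nhds h] with s hs using if_pos (le_of_lt hs)
  · rw [if_neg (not_le.mpr h)]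
    refine hy.congr_of_eventuallyEq ?_
    filter_upwards [Ioi_mem_nhds h] with s hs using if_neg (not_le.mpr hs)

theorem IsTrajectory.comp_sub {E : Type*} [NormedAddCommGroup E] [NormedSpace ℝ E] {m : ℕ}
    {A : E →L[ℝ] E} {B : (Fin m → ℝ) →L[ℝ] E} {u : ℝ → Fin m → ℝ} {x : ℝ → E}
    (h : IsTrajectory A B u x) (c : ℝ) :
    IsTrajectory A B (fun t => u (t - c)) (fun t => x (t - c)) :=
  ⟨h.1.comp (by fun_prop), fun t => by simpa using (h.2 (t - c)).comp_sub_const t c⟩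

theorem exists_isTrajectory_zero_input {E : Type*} [NormedAddCommGroup E] [NormedSpace ℝ E]
    [CompleteSpace E] {m : ℕ} (A : E →L[ℝ] E) (B : (Fin m → ℝ) →L[ℝ] E) (v : E) (c : ℝ) :
    ∃ x, IsTrajectory A B 0 x ∧ x c = v := by
  have h : IsTrajectory A B 0 fun t : ℝ => NormedSpace.exp (t • A) v := by
    refine ⟨continuous_zero, fun t => ?_⟩
    have := (hasDerivAt_exp_smul_const' (𝕂 := ℝ) A t).clm_apply (hasDerivAt_const t v)
    simpa using this
  exact ⟨_, h.comp_sub c, by simp⟩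

/-- An OFP resource has a finite available storage along a trajectory that starts in a
reachable state. -/
theorem IBR.exists_storage_bound (g : IBR) {σ : ℝ} (hσ : IsOFPWith g.inputOutput σ)
    {u : ℝ → Fin 2 → ℝ} {x : ℝ → Fin g.dim → ℝ}
    (hx : IsTrajectory g.A.mulVecCLM g.B.mulVecCLM u x)
    (hx0 : x 0 ∈ reachableSubmodule g.A.mulVecCLM g.B.mulVecCLM) :
    ∃ K : ℝ, ∀ T : ℝ, 0 ≤ T → 0 ≤ K + ∫ τ in (0 : ℝ)..T,
      (u τ ⬝ᵥ (g.C *ᵥ x τ) - σ * ((g.C *ᵥ x τ) ⬝ᵥ (g.C *ᵥ x τ))) := by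
  obtain ⟨u₁, x₁, hx₁, hx₁0, hx₁1⟩ := hx0
  -- The constant is the supply spent on steering from the origin to `x 0`, which does not depend on
  -- `T`.
  refine ⟨∫ τ in (0 : ℝ)..1,
    (u₁ τ ⬝ᵥ (g.C *ᵥ x₁ τ) - σ * ((g.C *ᵥ x₁ τ) ⬝ᵥ (g.C *ᵥ x₁ τ))), fun T hT => ?_⟩
  -- A zero-state trajectory must exist for all times, so the state runs freely after `1 + T`.
  obtain ⟨x₃, hx₃, hx₃0⟩ :=
    exists_isTrajectory_zero_input g.A.mulVecCLM g.B.mulVecCLM (x T) (1 + T)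
  have hx₂ := hx.comp_sub 1
  -- The truncation makes the input square integrable even if `u` grows. `U` may jump at the
  -- switching times, where `X` is continuous but need not be differentiable.
  let U : ℝ → Fin 2 → ℝ := (Set.Ioc 0 1).indicator u₁ +
    (Set.Ioc 1 (1 + T)).indicator fun t => u (t - 1)
  let X : ℝ → Fin g.dim → ℝ := fun t =>
    if t ≤ 1 then x₁ t else if t ≤ 1 + T then x (t - 1) else x₃ t
  have hUmem : ∀ p, MemLp U p volume := fun p =>
    (memLp_indicator_Ioc_of_continuous hx₁.1 0 1 p).add
      (memLp_indicator_Ioc_of_continuous hx₂.1 1 (1 + T) p)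
  have hU : ∀ t, 0 < t → U t = if t ≤ 1 then u₁ t else if t ≤ 1 + T then u (t - 1) else 0 := by
    intro t ht
    by_cases h1 : t ≤ 1
    · simp [U, h1, ht, not_lt.mpr h1]
    · by_cases h2 : t ≤ 1 + T
      · simp [U, h1, h2, not_le.mp h1]
      · simp [U, h1, h2]
  have hXc : Continuous X := by
    refine Continuous.if_le hx₁.continuous (Continuous.if_le hx₂.continuous hx₃.continuous
      continuous_id continuous_const fun t ht => ?_) continuous_id continuous_const fun t ht => ?_
    · simp only [ht, hx₃0]; congr 1; ring
    · have ht' : t = 1 := ht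
      subst ht'
      simp [hx₁1, hT]
  have hXd : ∀ t, 0 < t → t ∉ ({1, 1 + T} : Set ℝ) →
      HasDerivAt X (g.A *ᵥ X t + g.B *ᵥ U t) t := by
    intro t ht hts
    rw [Set.mem_insert_iff, Set.mem_singleton_iff, not_or] at hts
    refine (hasDerivAt_ite_le hts.1 (hx₁.2 t)
      (hasDerivAt_ite_le hts.2 (hx₂.2 t) (hx₃.2 t))).congr_deriv ?_
    rw [hU t ht]
    simp only [X]
    split_ifs <;> simp
  have htraj : g.IsZeroStateTrajectory U X := by
    refine ⟨hXc.continuousOn, fun t ht => ?_⟩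
    have hint : IntervalIntegrable (fun τ => g.A *ᵥ X τ + g.B *ᵥ U τ) volume 0 t := by
      have h1 : Continuous fun τ => g.A *ᵥ X τ := g.A.mulVecCLM.continuous.comp hXc
      have h2 : Integrable (fun τ => g.B *ᵥ U τ) volume :=
        g.B.mulVecCLM.integrable_comp (memLp_one_iff_integrable.mp (hUmem 1))
      exact (h1.intervalIntegrable 0 t).add h2.intervalIntegrable
    rw [integral_eq_of_hasDerivAt_off_countable_of_le X _ ht
      ((Set.finite_singleton (1 + T)).insert 1).countable hXc.continuousOn
      (fun s hs => hXd s hs.1.1 hs.2) hint]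
    simp [X, hx₁0]
  have hofp := hσ U (fun t => g.C *ᵥ X t) ((hUmem 2).restrict _) ⟨X, htraj, fun _ _ => rfl⟩
    (1 + T) (by linarith)
  have hYc : Continuous fun t => g.C *ᵥ X t := g.C.mulVecCLM.continuous.comp hXc
  have hYYc : Continuous fun t => (g.C *ᵥ X t) ⬝ᵥ (g.C *ᵥ X t) := hYc.dotProduct hYc
  let P : (ℝ → Fin 2 → ℝ) → (ℝ → Fin g.dim → ℝ) → ℝ → ℝ := fun u x τ =>
    u τ ⬝ᵥ (g.C *ᵥ x τ) - σ * ((g.C *ᵥ x τ) ⬝ᵥ (g.C *ᵥ x τ))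
  have hPc : ∀ {u x}, IsTrajectory g.A.mulVecCLM g.B.mulVecCLM u x → Continuous (P u x) := by
    intro u x h
    have hy : Continuous fun t => g.C *ᵥ x t := g.C.mulVecCLM.continuous.comp h.continuous
    exact (h.1.dotProduct hy).sub ((hy.dotProduct hy).const_mul σ)
  have hG1 : ∀ τ ∈ Set.Ioc (0 : ℝ) 1, P u₁ x₁ τ = P U X τ := by
    intro τ hτ
    simp [P, hU τ hτ.1, X, hτ.2]
  have hG2 : ∀ τ ∈ Set.Ioc (1 : ℝ) (1 + T), P u x (τ - 1) = P U X τ := by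
    intro τ hτ
    simp [P, hU τ (by linarith [hτ.1]), X, hτ.2, not_le.mpr hτ.1]
  have hI1 : IntervalIntegrable (P U X) volume 0 1 :=
    ((hPc hx₁).intervalIntegrable 0 1).congr fun τ hτ => hG1 τ (by simpa using hτ)
  have hI2 : IntervalIntegrable (P U X) volume 1 (1 + T) :=
    ((hPc hx₂).intervalIntegrable 1 (1 + T)).congr fun τ hτ => hG2 τ (by
      rwa [Set.uIoc_of_le (by linarith)] at hτ)
  have hI := hI1.trans hI2
  have hYYi := (hYYc.const_mul σ).intervalIntegrable (μ := volume) 0 (1 + T)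
  have hUYi : IntervalIntegrable (fun τ => U τ ⬝ᵥ (g.C *ᵥ X τ)) volume 0 (1 + T) := by
    refine (hI.add hYYi).congr fun τ _ => ?_
    simp [P]
  rw [← intervalIntegral.integral_const_mul, ← intervalIntegral.integral_sub hUYi hYYi] at hofp
  change 0 ≤ ∫ τ in (0 : ℝ)..(1 + T), P U X τ at hofp
  rw [← intervalIntegral.integral_add_adjacent_intervals hI1 hI2] at hofp
  have e1 : ∫ τ in (0 : ℝ)..1, P U X τ = ∫ τ in (0 : ℝ)..1, P u₁ x₁ τ :=
    intervalIntegral.integral_congr_ae (Filter.Eventually.of_forall fun τ hτ =>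
      (hG1 τ (by simpa using hτ)).symm)
  have e2 : ∫ τ in (1 : ℝ)..(1 + T), P U X τ = ∫ τ in (0 : ℝ)..T, P u x τ := by
    have : ∫ τ in (1 : ℝ)..(1 + T), P U X τ = ∫ τ in (1 : ℝ)..(1 + T), P u x (τ - 1) :=
      intervalIntegral.integral_congr_ae (Filter.Eventually.of_forall fun τ hτ =>
        (hG2 τ (by rwa [Set.uIoc_of_le (by linarith)] at hτ)).symm)
    rw [this, intervalIntegral.integral_comp_sub_right (P u x)]
    simp
  rw [e1, e2] at hofp
  exact hofp

end Dissipation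

/-! ### Energy balance of the microgrid -/

section Microgrid

variable {N M : ℕ}

theorem IBR.inv_T (g : IBR) : g.T⁻¹ = g.Tᵀ := by
  refine Matrix.inv_eq_left_inv ?_
  have h := Real.sin_sq_add_cos_sq g.δ
  ext i j
  fin_cases i <;> fin_cases j <;> simp [IBR.T, Matrix.mul_apply, Fin.sum_univ_two] <;> linarith

/-- The change of frame preserves power, since the rotation is orthogonal. -/
theorem IBR.inv_T_mulVec_dotProduct (g : IBR) (p y : Fin 2 → ℝ) :
    (g.T⁻¹ *ᵥ p) ⬝ᵥ y = p ⬝ᵥ (g.T *ᵥ y) := by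
  rw [g.inv_T, Matrix.mulVec_transpose, ← Matrix.dotProduct_mulVec]

/-- Tellegen's theorem: currents and voltages are transformed by mutually transposed matrices. -/
theorem RLNetwork.sum_branch_power (net : RLNetwork N M) (i : Fin M → Fin 2 → ℝ)
    (v : Fin N → Fin 2 → ℝ) :
    ∑ m, i m ⬝ᵥ net.branchVoltage v m = ∑ n, net.nodalCurrent i n ⬝ᵥ v n := by
  have h : ∀ a : Fin 2, ∑ m, i m a * net.branchVoltage v m a =
      ∑ n, net.nodalCurrent i n a * v n a := by
    intro a
    change (fun m => i m a) ⬝ᵥ (net.C₀ᵀ *ᵥ fun n => v n a) =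
      (net.C₀ *ᵥ fun m => i m a) ⬝ᵥ fun n => v n a
    rw [Matrix.mulVec_transpose, dotProduct_comm, ← Matrix.dotProduct_mulVec, dotProduct_comm]
  simp only [dotProduct, Fin.sum_univ_two, Finset.sum_add_distrib, h]

/-- The `ω₀` terms couple the D and Q axes skew-symmetrically and so cancel from the power. -/
theorem RLNetwork.inductor_power (net : RLNetwork N M) (i : Fin M → Fin 2 → ℝ)
    (v : Fin N → Fin 2 → ℝ) (m : Fin M) :
    net.L m * (i m ⬝ᵥ net.branchDynamics i v m) =
      -(net.r m * (i m ⬝ᵥ i m)) + i m ⬝ᵥ net.branchVoltage v m := by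
  have hL := (net.L_pos m).ne'
  simp only [dotProduct, Fin.sum_univ_two, RLNetwork.branchDynamics, Matrix.cons_val_zero,
    Matrix.cons_val_one]
  field_simp
  ring

/-- The d-q input current of the `n`-th resource in the closed loop. -/
noncomputable def inputCurrent (g : Fin N → IBR) (net : RLNetwork N M) (s : MicrogridState M g) (n : Fin N) :
    Fin 2 → ℝ :=
  (g n).T⁻¹ *ᵥ (-net.nodalCurrent s.2 n)

/-- The magnetic energy stored in the branches. -/
noncomputable def storedEnergy {g : Fin N → IBR} (net : RLNetwork N M) (s : MicrogridState M g) : ℝ :=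
  ∑ m, net.L m / 2 * (s.2 m ⬝ᵥ s.2 m)

/-- The dissipation rate: the resistive losses and the excess of passivity of the resources. -/
noncomputable def dissipation (g : Fin N → IBR) (net : RLNetwork N M) (σ : Fin N → ℝ)
    (s : MicrogridState M g) : ℝ :=
  (∑ n, σ n * (((g n).C *ᵥ s.1 n) ⬝ᵥ ((g n).C *ᵥ s.1 n))) + ∑ m, net.r m * (s.2 m ⬝ᵥ s.2 m)

/-- The power supplied to the resources enters with a minus sign because of the negative feedback;
it cancels against their passivity inequalities. -/
theorem sum_inductor_power (g : Fin N → IBR) (net : RLNetwork N M) (s : MicrogridState M g) :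
    ∑ m, net.L m * (s.2 m ⬝ᵥ (closedLoop g net s).2 m) =
      -(∑ m, net.r m * (s.2 m ⬝ᵥ s.2 m)) -
        ∑ n, inputCurrent g net s n ⬝ᵥ ((g n).C *ᵥ s.1 n) := by
  have h1 : ∀ n, inputCurrent g net s n ⬝ᵥ ((g n).C *ᵥ s.1 n) =
      -(net.nodalCurrent s.2 n ⬝ᵥ terminalVoltage g s.1 n) := by
    intro n
    rw [inputCurrent, IBR.inv_T_mulVec_dotProduct, neg_dotProduct, terminalVoltage]
  simp only [closedLoop, RLNetwork.inductor_power, h1, Finset.sum_add_distrib,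
    Finset.sum_neg_distrib, RLNetwork.sum_branch_power]
  ring

theorem storedEnergy_nonneg {g : Fin N → IBR} (net : RLNetwork N M) (s : MicrogridState M g) :
    0 ≤ storedEnergy net s :=
  Finset.sum_nonneg fun m _ => mul_nonneg (half_pos (net.L_pos m)).le
    (Finset.sum_nonneg fun _ _ => mul_self_nonneg _)

/-- The closed-loop vector field as a linear map. -/
noncomputable def closedLoopLinear (g : Fin N → IBR) (net : RLNetwork N M) :
    MicrogridState M g →ₗ[ℝ] MicrogridState M g where
  toFun := closedLoop g net
  map_add' s t := by
    refine Prod.ext (funext fun n => ?_) (funext fun m => funext fun a => ?_)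
    · have h : net.nodalCurrent (s.2 + t.2) n =
          net.nodalCurrent s.2 n + net.nodalCurrent t.2 n := by
        ext a
        simp [RLNetwork.nodalCurrent, Matrix.mulVec, dotProduct, mul_add, Finset.sum_add_distrib]
      simp only [closedLoop, Prod.fst_add, Prod.snd_add, Pi.add_apply, h, neg_add,
        Matrix.mulVec_add]
      abel
    · have h : ∀ a, net.branchVoltage (terminalVoltage g (s.1 + t.1)) m a =
          net.branchVoltage (terminalVoltage g s.1) m a +
            net.branchVoltage (terminalVoltage g t.1) m a := by
        intro a
        simp [RLNetwork.branchVoltage, terminalVoltage, Matrix.mulVec_add]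
        simp [Matrix.mulVec, dotProduct, mul_add, Finset.sum_add_distrib]
      fin_cases a <;> simp [closedLoop, RLNetwork.branchDynamics, h] <;> ring
  map_smul' c s := by
    refine Prod.ext (funext fun n => ?_) (funext fun m => funext fun a => ?_)
    · have h : net.nodalCurrent (c • s.2) n = c • net.nodalCurrent s.2 n := by
        ext a
        simp [RLNetwork.nodalCurrent, Matrix.mulVec, dotProduct, mul_left_comm, Finset.mul_sum]
      simp only [closedLoop, Prod.smul_fst, Prod.smul_snd, Pi.smul_apply, h, ← smul_neg,
        Matrix.mulVec_smul, smul_add, RingHom.id_apply]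
    · have h : ∀ a, net.branchVoltage (terminalVoltage g (c • s.1)) m a =
          c * net.branchVoltage (terminalVoltage g s.1) m a := by
        intro a
        simp [RLNetwork.branchVoltage, terminalVoltage, Matrix.mulVec_smul]
        simp [Matrix.mulVec, dotProduct, mul_left_comm, Finset.mul_sum]
      fin_cases a <;> simp [closedLoop, RLNetwork.branchDynamics, h] <;> ring

theorem closedLoopLinear_apply (g : Fin N → IBR) (net : RLNetwork N M) (s : MicrogridState M g) :
    closedLoopLinear g net s = closedLoop g net s := rfl

/-- Along closed-loop solutions that start with reachable resource states, the total dissipation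
is bounded. -/
theorem exists_integral_dissipation_le (g : Fin N → IBR) (net : RLNetwork N M) (σ : Fin N → ℝ)
    (hσ : ∀ n, IsOFPWith (g n).inputOutput (σ n)) (s : ℝ → MicrogridState M g)
    (hs : ∀ t, HasDerivAt s (closedLoop g net (s t)) t)
    (hs0 : ∀ n, (s 0).1 n ∈ reachableSubmodule (g n).A.mulVecCLM (g n).B.mulVecCLM) :
    ∃ K : ℝ, ∀ T : ℝ, 0 ≤ T → ∫ τ in (0 : ℝ)..T, dissipation g net σ (s τ) ≤ K := by
  have hsc : Continuous s := continuous_iff_continuousAt.mpr fun t => (hs t).continuousAt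
  have hx : ∀ n t, HasDerivAt (fun t => (s t).1 n) ((closedLoop g net (s t)).1 n) t := fun n t =>
    hasDerivAt_pi.mp ((ContinuousLinearMap.fst ℝ _ _).hasFDerivAt.comp_hasDerivAt t (hs t)) n
  have hi : ∀ m t, HasDerivAt (fun t => (s t).2 m) ((closedLoop g net (s t)).2 m) t := fun m t =>
    hasDerivAt_pi.mp ((ContinuousLinearMap.snd ℝ _ _).hasFDerivAt.comp_hasDerivAt t (hs t)) m
  have hxc : ∀ n, Continuous fun t => (s t).1 n := fun n => by fun_prop
  have hic : ∀ m, Continuous fun t => (s t).2 m := fun m => by fun_prop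
  have huc : ∀ n, Continuous fun t => inputCurrent g net (s t) n := by
    intro n
    have h1 : Continuous fun t => net.nodalCurrent (s t).2 n := by
      refine continuous_pi fun a => ?_
      simp only [RLNetwork.nodalCurrent, Matrix.mulVec, dotProduct]
      fun_prop
    exact (g n).T⁻¹.mulVecCLM.continuous.comp h1.neg
  have hyc : ∀ n, Continuous fun t => (g n).C *ᵥ (s t).1 n := fun n =>
    (g n).C.mulVecCLM.continuous.comp (hxc n)
  choose K hK using fun n => (g n).exists_storage_bound (hσ n)
    (u := fun t => inputCurrent g net (s t) n) (x := fun t => (s t).1 n)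
    ⟨huc n, fun t => hx n t⟩ (hs0 n)
  have hpc : ∀ n, Continuous fun τ => inputCurrent g net (s τ) n ⬝ᵥ ((g n).C *ᵥ (s τ).1 n) -
      σ n * (((g n).C *ᵥ (s τ).1 n) ⬝ᵥ ((g n).C *ᵥ (s τ).1 n)) := fun n =>
    ((huc n).dotProduct (hyc n)).sub (((hyc n).dotProduct (hyc n)).const_mul (σ n))
  have hVd : ∀ t, HasDerivAt (fun t => storedEnergy net (s t))
      (∑ m, net.L m * ((s t).2 m ⬝ᵥ (closedLoop g net (s t)).2 m)) t := by
    intro t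
    refine HasDerivAt.fun_sum fun m _ => ?_
    have h0 := hasDerivAt_pi.mp (hi m t) 0
    have h1 := hasDerivAt_pi.mp (hi m t) 1
    simp only [dotProduct, Fin.sum_univ_two]
    refine (((h0.mul h0).add (h1.mul h1)).const_mul (net.L m / 2)).congr_deriv ?_
    ring
  have hV'c : Continuous fun t =>
      ∑ m, net.L m * ((s t).2 m ⬝ᵥ (closedLoop g net (s t)).2 m) := by
    simp only [sum_inductor_power]
    refine Continuous.sub (Continuous.neg ?_) ?_
    · exact continuous_finsetSum _ fun m _ => ((hic m).dotProduct (hic m)).const_mul _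
    · exact continuous_finsetSum _ fun n _ => (huc n).dotProduct (hyc n)
  -- The bound is the energy available at the start: that of the resources plus that of the
  -- inductors.
  refine ⟨(∑ n, K n) + storedEnergy net (s 0), fun T hT => ?_⟩
  have hE := intervalIntegral.integral_eq_sub_of_hasDerivAt (fun t _ => hVd t)
    (hV'c.intervalIntegrable 0 T)
  have hsum : 0 ≤ ∑ n, (K n + ∫ τ in (0 : ℝ)..T,
      (inputCurrent g net (s τ) n ⬝ᵥ ((g n).C *ᵥ (s τ).1 n) -
        σ n * (((g n).C *ᵥ (s τ).1 n) ⬝ᵥ ((g n).C *ᵥ (s τ).1 n)))) :=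
    Finset.sum_nonneg fun n _ => hK n T hT
  rw [Finset.sum_add_distrib, ← intervalIntegral.integral_finsetSum
    (fun n _ => (hpc n).intervalIntegrable 0 T)] at hsum
  have hD : ∫ τ in (0 : ℝ)..T, dissipation g net σ (s τ) =
      -(∫ τ in (0 : ℝ)..T, ∑ n, (inputCurrent g net (s τ) n ⬝ᵥ ((g n).C *ᵥ (s τ).1 n) -
        σ n * (((g n).C *ᵥ (s τ).1 n) ⬝ᵥ ((g n).C *ᵥ (s τ).1 n)))) -
      ∫ τ in (0 : ℝ)..T, ∑ m, net.L m * ((s τ).2 m ⬝ᵥ (closedLoop g net (s τ)).2 m) := by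
    have hneg : Continuous fun τ => -∑ n, (inputCurrent g net (s τ) n ⬝ᵥ ((g n).C *ᵥ (s τ).1 n) -
        σ n * (((g n).C *ᵥ (s τ).1 n) ⬝ᵥ ((g n).C *ᵥ (s τ).1 n))) :=
      (continuous_finsetSum _ fun n _ => hpc n).neg
    rw [← intervalIntegral.integral_neg, ← intervalIntegral.integral_sub
      (hneg.intervalIntegrable 0 T) (hV'c.intervalIntegrable 0 T)]
    refine intervalIntegral.integral_congr fun τ _ => ?_
    simp only [sum_inductor_power, dissipation, Finset.sum_sub_distrib]
    ring
  have := storedEnergy_nonneg net (s T)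
  linarith

/-- The sum over real and imaginary parts is a Hermitian form, so multiplying `a + b i` by `c + d i`
scales it by the squared modulus. -/
theorem dissipation_rotate (g : Fin N → IBR) (net : RLNetwork N M) (σ : Fin N → ℝ)
    (a b : MicrogridState M g) (c d : ℝ) :
    dissipation g net σ (c • a - d • b) + dissipation g net σ (d • a + c • b) =
      (c ^ 2 + d ^ 2) * (dissipation g net σ a + dissipation g net σ b) := by
  have h : ∀ p q : Fin 2 → ℝ, (c • p - d • q) ⬝ᵥ (c • p - d • q) +
      (d • p + c • q) ⬝ᵥ (d • p + c • q) = (c ^ 2 + d ^ 2) * (p ⬝ᵥ p + q ⬝ᵥ q) := by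
    intro p q
    simp only [dotProduct, Fin.sum_univ_two, Pi.add_apply, Pi.sub_apply, Pi.smul_apply,
      smul_eq_mul]
    ring
  simp only [dissipation, Prod.fst_add, Prod.snd_add, Prod.fst_sub, Prod.snd_sub, Prod.smul_fst,
    Prod.smul_snd, Pi.add_apply, Pi.sub_apply, Pi.smul_apply, Matrix.mulVec_add,
    Matrix.mulVec_sub, Matrix.mulVec_smul]
  conv_lhs => rw [add_add_add_comm]
  conv_rhs => rw [add_add_add_comm]
  simp only [← Finset.sum_add_distrib, ← mul_add, h]
  rw [mul_add, Finset.mul_sum, Finset.mul_sum]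
  congr 1 <;> exact Finset.sum_congr rfl fun _ _ => mul_left_comm _ _ _

/-- These are the real and imaginary parts of `exp ((α + β i) t) (a + b i)`. -/
theorem hasDerivAt_mode {E : Type*} [NormedAddCommGroup E] [NormedSpace ℝ E] (f : E →ₗ[ℝ] E)
    {α β : ℝ} {a b : E} (ha : f a = α • a - β • b) (hb : f b = β • a + α • b) (t : ℝ) :
    HasDerivAt (fun t : ℝ => (Real.exp (α * t) * Real.cos (β * t)) • a -
        (Real.exp (α * t) * Real.sin (β * t)) • b)
      (f ((Real.exp (α * t) * Real.cos (β * t)) • a -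
        (Real.exp (α * t) * Real.sin (β * t)) • b)) t ∧
    HasDerivAt (fun t : ℝ => (Real.exp (α * t) * Real.sin (β * t)) • a +
        (Real.exp (α * t) * Real.cos (β * t)) • b)
      (f ((Real.exp (α * t) * Real.sin (β * t)) • a +
        (Real.exp (α * t) * Real.cos (β * t)) • b)) t := by
  have he := ((hasDerivAt_id t).const_mul α).exp
  have hc := ((hasDerivAt_id t).const_mul β).cos
  have hs := ((hasDerivAt_id t).const_mul β).sin
  simp only [id, mul_one] at he hc hs
  constructor
  · refine (((he.mul hc).smul_const a).sub ((he.mul hs).smul_const b)).congr_deriv ?_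
    simp only [map_sub, map_smul, ha, hb]
    module
  · refine (((he.mul hs).smul_const a).add ((he.mul hc).smul_const b)).congr_deriv ?_
    simp only [map_add, map_smul, ha, hb]
    module

/-- A mode of the closed loop with nonnegative real part does not dissipate. -/
theorem dissipation_eq_zero_of_mode (g : Fin N → IBR) (net : RLNetwork N M) (σ : Fin N → ℝ)
    (hσ : ∀ n, IsOFPWith (g n).inputOutput (σ n)) (hstab : ∀ n, (g n).IsStabilizable)
    {α β : ℝ} (hα : 0 ≤ α) {a b : MicrogridState M g}
    (ha : closedLoop g net a = α • a - β • b) (hb : closedLoop g net b = β • a + α • b) :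
    dissipation g net σ a + dissipation g net σ b ≤ 0 := by
  have hreach : ∀ n, a.1 n ∈ reachableSubmodule (g n).A.mulVecCLM (g n).B.mulVecCLM ∧
      b.1 n ∈ reachableSubmodule (g n).A.mulVecCLM (g n).B.mulVecCLM := fun n =>
    (g n).mem_reachableSubmodule_of_mode (hstab n) α β hα (a.1 n) (b.1 n) _ _
      (congrFun (congrArg Prod.fst ha) n) (congrFun (congrArg Prod.fst hb) n)
  have hmode := hasDerivAt_mode (closedLoopLinear g net) ha hb
  obtain ⟨K₁, hK₁⟩ := exists_integral_dissipation_le g net σ hσ _ (fun t => (hmode t).1)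
    (fun n => by simpa using (hreach n).1)
  obtain ⟨K₂, hK₂⟩ := exists_integral_dissipation_le g net σ hσ _ (fun t => (hmode t).2)
    (fun n => by simpa using (hreach n).2)
  have hcont : ∀ x : ℝ → MicrogridState M g, Continuous x →
      Continuous fun t => dissipation g net σ (x t) := by
    intro x hx
    refine Continuous.add ?_ ?_
    · refine continuous_finsetSum _ fun n _ => Continuous.const_mul ?_ _
      have : Continuous fun t => (g n).C *ᵥ (x t).1 n :=
        (g n).C.mulVecCLM.continuous.comp (by fun_prop)
      exact this.dotProduct this
    · refine continuous_finsetSum _ fun m _ => Continuous.const_mul ?_ _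
      have : Continuous fun t => (x t).2 m := by fun_prop
      exact this.dotProduct this
  have hc1 := hcont _ (continuous_iff_continuousAt.mpr fun t => (hmode t).1.continuousAt)
  have hc2 := hcont _ (continuous_iff_continuousAt.mpr fun t => (hmode t).2.continuousAt)
  set Q := dissipation g net σ a + dissipation g net σ b with hQ
  by_contra! hpos
  -- The combined dissipation at time `t` is `exp (α t) ^ 2 * Q`, at least `Q`, so its integral
  -- grows at least linearly in `T`.
  have hbound : ∀ T : ℝ, 0 ≤ T → T * Q ≤ K₁ + K₂ := by
    intro T hT
    have h := add_le_add (hK₁ T hT) (hK₂ T hT)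
    rw [← intervalIntegral.integral_add (hc1.intervalIntegrable 0 T)
      (hc2.intervalIntegrable 0 T)] at h
    refine le_trans ?_ h
    have hconst : ∫ _ in (0 : ℝ)..T, Q = T * Q := by simp
    rw [← hconst]
    refine intervalIntegral.integral_mono_on hT (by simp)
      ((hc1.add hc2).intervalIntegrable 0 T) fun t ht => ?_
    rw [dissipation_rotate, ← hQ]
    have h1 : 1 ≤ Real.exp (α * t) := Real.one_le_exp (mul_nonneg hα ht.1)
    have h2 : (Real.exp (α * t) * Real.cos (β * t)) ^ 2 +
        (Real.exp (α * t) * Real.sin (β * t)) ^ 2 = Real.exp (α * t) ^ 2 := by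
      have := Real.sin_sq_add_cos_sq (β * t)
      linear_combination Real.exp (α * t) ^ 2 * this
    rw [h2]
    exact le_mul_of_one_le_left hpos.le (one_le_pow₀ h1)
  have h := hbound ((|K₁ + K₂| + 1) / Q) (by positivity)
  rw [div_mul_cancel₀ _ hpos.ne'] at h
  linarith [le_abs_self (K₁ + K₂)]

theorem eq_zero_of_dissipation_nonpos (g : Fin N → IBR) (net : RLNetwork N M) (σ : Fin N → ℝ)
    (hσ : ∀ n, 0 < σ n) {a b : MicrogridState M g}
    (h : dissipation g net σ a + dissipation g net σ b ≤ 0) :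
    (∀ n, (g n).C *ᵥ a.1 n = 0) ∧ a.2 = 0 := by
  have hnn : ∀ p : Fin 2 → ℝ, 0 ≤ p ⬝ᵥ p := fun p =>
    Finset.sum_nonneg fun _ _ => mul_self_nonneg _
  have h1 : ∀ s : MicrogridState M g,
      ∀ n ∈ Finset.univ, 0 ≤ σ n * (((g n).C *ᵥ s.1 n) ⬝ᵥ ((g n).C *ᵥ s.1 n)) :=
    fun s n _ => mul_nonneg (hσ n).le (hnn _)
  have h2 : ∀ s : MicrogridState M g, ∀ m ∈ Finset.univ, 0 ≤ net.r m * (s.2 m ⬝ᵥ s.2 m) :=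
    fun s m _ => mul_nonneg (net.r_pos m).le (hnn _)
  have ha1 := Finset.sum_nonneg (h1 a)
  have ha2 := Finset.sum_nonneg (h2 a)
  have hb1 := Finset.sum_nonneg (h1 b)
  have hb2 := Finset.sum_nonneg (h2 b)
  simp only [dissipation] at h
  constructor
  · intro n
    have := (Finset.sum_eq_zero_iff_of_nonneg (h1 a)).mp (by linarith) n (Finset.mem_univ n)
    exact dotProduct_self_eq_zero.mp ((mul_eq_zero.mp this).resolve_left (hσ n).ne')
  · ext1 m
    have := (Finset.sum_eq_zero_iff_of_nonneg (h2 a)).mp (by linarith) m (Finset.mem_univ m)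
    exact dotProduct_self_eq_zero.mp ((mul_eq_zero.mp this).resolve_left (net.r_pos m).ne')

/-- Detectability applied to the complex vector `a + b i` with eigenvalue `α + β i`. -/
theorem IBR.eq_zero_of_unobservable_mode (g : IBR) (hdet : g.IsDetectable) {α β : ℝ}
    (hα : 0 ≤ α) {a b : Fin g.dim → ℝ} (ha : g.A *ᵥ a = α • a - β • b)
    (hb : g.A *ᵥ b = β • a + α • b) (hCa : g.C *ᵥ a = 0) (hCb : g.C *ᵥ b = 0) :
    a = 0 ∧ b = 0 := by
  have h := hdet ⟨α, β⟩ hα (fun i => ⟨a i, b i⟩)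
    (by
      rw [Matrix.map_ofReal_mulVec, ha, hb]
      ext i
      apply Complex.ext
      · simp
      · simp [add_comm])
    (by
      rw [Matrix.map_ofReal_mulVec, hCa, hCb]
      rfl)
  exact ⟨funext fun i => congrArg Complex.re (congrFun h i),
    funext fun i => congrArg Complex.im (congrFun h i)⟩

end Microgrid

theorem theorem2 {N M : ℕ} (g : Fin N → IBR) (net : RLNetwork N M)
    (hstab : ∀ n, (g n).IsStabilizable) (hdet : ∀ n, (g n).IsDetectable)
    (hprotocol : FollowsProtocol g) :
    IsAsymptoticallyStableOrigin (closedLoop g net) := by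
  choose σ hσ hofp using hprotocol
  refine isAsymptoticallyStableOrigin_of_modes (closedLoopLinear g net) ?_
  intro α β a b hα ha hb
  rw [closedLoopLinear_apply] at ha hb
  have hdis := dissipation_eq_zero_of_mode g net σ hofp hstab hα ha hb
  obtain ⟨hCa, hia⟩ := eq_zero_of_dissipation_nonpos g net σ hσ hdis
  obtain ⟨hCb, hib⟩ := eq_zero_of_dissipation_nonpos g net σ hσ ((add_comm _ _).trans_le hdis)
  have hnodal : ∀ n, net.nodalCurrent 0 n = 0 := fun n => by
    ext c
    simp [RLNetwork.nodalCurrent, Matrix.mulVec, dotProduct]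
  -- Without branch currents the resources receive no input and decouple, leaving an eigenvector of
  -- each single `A`.
  have hx : ∀ n, a.1 n = 0 ∧ b.1 n = 0 := by
    intro n
    have h1 := congrFun (congrArg Prod.fst ha) n
    have h2 := congrFun (congrArg Prod.fst hb) n
    simp only [closedLoop, hia, hib, hnodal, neg_zero, Matrix.mulVec_zero, add_zero] at h1 h2
    exact (g n).eq_zero_of_unobservable_mode (hdet n) hα h1 h2 (hCa n) (hCb n)
  exact ⟨Prod.ext (funext fun n => (hx n).1) hia, Prod.ext (funext fun n => (hx n).2) hib⟩
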